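/- Let $k$ be a field, let $n\ge 1$, and let $A$ and $B$ be finite-dimensional $k$-algebras. "Module" means left module, and bimodules are finite-dimensional with $k$ acting centrally. A finitely generated $A$-module $T$ is called $n$-cluster tilting if $$\operatorname{add}(T)=\{X\in A\text{-mod}\mid \operatorname{Ext}^i_A(X,T)=0,\ 1\le i<n\}=\{X\in A\text{-mod}\mid \operatorname{Ext}^i_A(T,X)=0,\ 1\le i<n\},$$ where $A$-mod is the category of finitely generated $A$-modules and $\operatorname{add}(T)$ consists of the direct summands of finite direct sums of copies of $T$. The algebra $A$ is called $n$-representation-finite if it has an $n$-cluster tilting module and, in case $n\ge 2$, also $\operatorname{gl.dim}(A)\le n$. Bimodules ${}_AM_B$ and ${}_BN_A$ define a stable equivalence of Morita type between $A$ and $B$ if $M$ and $N$ are projective as left and as right modules, and $M\otimes_B N\simeq A\oplus P$ as $A$-$A$-bimodules and $N\otimes_A M\simeq B\oplus Q$ as $B$-$B$-bimodules, for some projective $A$-$A$-bimodule $P$ and some projective $B$-$B$-bimodule $Q$. If such $M$ and $N$ exist, $A$ and $B$ are called stably equivalent of Morita type. Suppose that neither $A$ nor $B$ has a nonzero separable $k$-algebra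 as a direct factor, and that the $k$-algebras $A/\operatorname{rad}(A)$ and $B/\operatorname{rad}(B)$ are separable. Suppose that $A$ is $n$-representation-finite. (1) If $A$ and $B$ are stably equivalent of Morita type, then $B$ is $n$-representation-finite. (2) If ${}_AM_B$ and ${}_BN_A$ define a stable equivalence of Morita type between $A$ and $B$, and $T$ is an $n$-cluster tilting $A$-module, then $N\otimes_A T$ is an $n$-cluster tilting $B$-module. -/

import Mathlib

open scoped TensorProduct
open MulOpposite CategoryTheory

universe u w

/-! ### The tensor product of a right module and a left module over a noncommutative ring -/

section BalancedTensor

/-- The subgroup of `X ⊗[ℤ] Y` generated by the elements `x r ⊗ y - x ⊗ r y`. -/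
def balancedRelations (R X Y : Type u) [Ring R] [AddCommGroup X] [Module Rᵐᵒᵖ X]
    [AddCommGroup Y] [Module R Y] : AddSubgroup (X ⊗[ℤ] Y) :=
  AddSubgroup.closure
    {z | ∃ (x : X) (r : R) (y : Y), z = (op r • x) ⊗ₜ[ℤ] y - x ⊗ₜ[ℤ] (r • y)}

/-- The tensor product of the right `R`-module `X` and the left `R`-module `Y` over the (possibly
noncommutative) ring `R`. -/
def BalancedTensor (R X Y : Type u) [Ring R] [AddCommGroup X] [Module Rᵐᵒᵖ X]
    [AddCommGroup Y] [Module R Y] : Type u :=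
  (X ⊗[ℤ] Y) ⧸ balancedRelations R X Y

namespace BalancedTensor

variable (R X Y : Type u) [Ring R] [AddCommGroup X] [Module Rᵐᵒᵖ X] [AddCommGroup Y] [Module R Y]

instance : AddCommGroup (BalancedTensor R X Y) :=
  inferInstanceAs (AddCommGroup ((X ⊗[ℤ] Y) ⧸ balancedRelations R X Y))

variable {X Y}

/-- The class of the pure tensor `x ⊗ y`. -/
def tmul (x : X) (y : Y) : BalancedTensor R X Y :=
  QuotientAddGroup.mk' (balancedRelations R X Y) (x ⊗ₜ[ℤ] y)

theorem tmul_balanced (x : X) (r : R) (y : Y) : tmul R (op r • x) y = tmul R x (r • y) := by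
  rw [← sub_eq_zero]
  change QuotientAddGroup.mk' (balancedRelations R X Y) _
    - QuotientAddGroup.mk' (balancedRelations R X Y) _ = 0
  rw [← map_sub]
  exact (QuotientAddGroup.eq_zero_iff _).2 (AddSubgroup.subset_closure ⟨x, r, y, rfl⟩)

theorem add_tmul (x x' : X) (y : Y) : tmul R (x + x') y = tmul R x y + tmul R x' y := by
  rw [tmul, TensorProduct.add_tmul, map_add]; rfl

theorem tmul_add (x : X) (y y' : Y) : tmul R x (y + y') = tmul R x y + tmul R x y' := by
  rw [tmul, TensorProduct.tmul_add, map_add]; rfl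

theorem zero_tmul (y : Y) : tmul R (0 : X) y = 0 := by
  rw [tmul, TensorProduct.zero_tmul, map_zero]; rfl

theorem tmul_zero (x : X) : tmul R x (0 : Y) = 0 := by
  rw [tmul, TensorProduct.tmul_zero, map_zero]; rfl

variable {R}

/-- Additive maps out of the tensor product agree if they agree on pure tensors. -/
theorem hom_ext {G : Type*} [AddCommGroup G] {f g : BalancedTensor R X Y →+ G}
    (h : ∀ x y, f (tmul R x y) = g (tmul R x y)) : f = g := by
  ext z
  obtain ⟨z, rfl⟩ := QuotientAddGroup.mk'_surjective (balancedRelations R X Y) z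
  induction z with
  | zero => rw [map_zero]; exact (map_zero f).trans (map_zero g).symm
  | tmul x y => exact h x y
  | add a b ha hb =>
    rw [map_add]
    exact (map_add f _ _).trans ((congrArg₂ (· + ·) ha hb).trans (map_add g _ _).symm)

/-- The map `f ⊗ g` induced by a map `f` of right modules and a map `g` of left modules. -/
def map {X' Y' : Type u} [AddCommGroup X'] [Module Rᵐᵒᵖ X'] [AddCommGroup Y'] [Module R Y']
    (f : X →ₗ[Rᵐᵒᵖ] X') (g : Y →ₗ[R] Y') : BalancedTensor R X Y →+ BalancedTensor R X' Y' :=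
  QuotientAddGroup.map (balancedRelations R X Y) (balancedRelations R X' Y')
    (TensorProduct.map f.toAddMonoidHom.toIntLinearMap
      g.toAddMonoidHom.toIntLinearMap).toAddMonoidHom
    (by
      rw [balancedRelations, AddSubgroup.closure_le]
      rintro _ ⟨x, r, y, rfl⟩
      exact AddSubgroup.subset_closure ⟨f x, r, g y, by simp⟩)

theorem map_tmul {X' Y' : Type u} [AddCommGroup X'] [Module Rᵐᵒᵖ X'] [AddCommGroup Y']
    [Module R Y'] (f : X →ₗ[Rᵐᵒᵖ] X') (g : Y →ₗ[R] Y') (x : X) (y : Y) :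
    map f g (tmul R x y) = tmul R (f x) (g y) := rfl

variable (R X Y)

/-- The action of `S` on `X ⊗ Y` through the first factor. -/
def leftAction (S : Type*) [Ring S] [Module S X] [SMulCommClass S Rᵐᵒᵖ X] :
    S →+* AddMonoid.End (BalancedTensor R X Y) where
  toFun s := map (Module.toModuleEnd Rᵐᵒᵖ X s) LinearMap.id
  map_one' := hom_ext fun x y => congrArg (tmul R · y) (one_smul S x)
  map_mul' s t := hom_ext fun x y => congrArg (tmul R · y) (mul_smul s t x)
  map_zero' := hom_ext fun x y => (congrArg (tmul R · y) (zero_smul S x)).trans (zero_tmul R y)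
  map_add' s t := hom_ext fun x y =>
    (congrArg (tmul R · y) (add_smul s t x)).trans (add_tmul R _ _ y)

/-- The action of `S` on `X ⊗ Y` through the second factor. -/
def rightAction (S : Type*) [Ring S] [Module S Y] [SMulCommClass S R Y] :
    S →+* AddMonoid.End (BalancedTensor R X Y) where
  toFun s := map LinearMap.id (Module.toModuleEnd R Y s)
  map_one' := hom_ext fun x y => congrArg (tmul R x) (one_smul S y)
  map_mul' s t := hom_ext fun x y => congrArg (tmul R x) (mul_smul s t y)
  map_zero' := hom_ext fun x y => (congrArg (tmul R x) (zero_smul S y)).trans (tmul_zero R x)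
  map_add' s t := hom_ext fun x y =>
    (congrArg (tmul R x) (add_smul s t y)).trans (tmul_add R x _ _)

/-- If `X` is an `S`-`R`-bimodule, then `X ⊗ Y` is a left `S`-module. -/
instance leftModule (S : Type*) [Ring S] [Module S X] [SMulCommClass S Rᵐᵒᵖ X] :
    Module S (BalancedTensor R X Y) :=
  Module.compHom _ (leftAction R X Y S)

/-- If `Y` is an `R`-`S`-bimodule, then `X ⊗ Y` is a right `S`-module. -/
instance rightModule (S : Type*) [Ring S] [Module Sᵐᵒᵖ Y] [SMulCommClass R Sᵐᵒᵖ Y] :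
    Module Sᵐᵒᵖ (BalancedTensor R X Y) :=
  haveI : SMulCommClass Sᵐᵒᵖ R Y := SMulCommClass.symm _ _ _
  Module.compHom _ (rightAction R X Y Sᵐᵒᵖ)

variable {R X Y}

theorem smul_tmul {S : Type*} [Ring S] [Module S X] [SMulCommClass S Rᵐᵒᵖ X]
    (s : S) (x : X) (y : Y) : s • tmul R x y = tmul R (s • x) y := rfl

theorem op_smul_tmul {S : Type*} [Ring S] [Module Sᵐᵒᵖ Y] [SMulCommClass R Sᵐᵒᵖ Y]
    (s : S) (x : X) (y : Y) : op s • tmul R x y = tmul R x (op s • y) := rfl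

end BalancedTensor

end BalancedTensor

/-! ### Finite-dimensional bimodules and stable equivalences of Morita type -/

/-- A finite-dimensional `A`-`B`-bimodule over `k` (with `k` acting centrally). -/
structure FDBimodule (k : Type w) (A B : Type u) [Field k] [Ring A] [Algebra k A]
    [Ring B] [Algebra k B] where
  carrier : Type u
  [addCommGroup : AddCommGroup carrier]
  [module : Module k carrier]
  [leftModule : Module A carrier]
  [rightModule : Module Bᵐᵒᵖ carrier]
  [leftTower : IsScalarTower k A carrier]
  [rightTower : IsScalarTower k Bᵐᵒᵖ carrier]
  [smulComm : SMulCommClass A Bᵐᵒᵖ carrier]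
  [finite : FiniteDimensional k carrier]

namespace FDBimodule

instance {k : Type w} {A B : Type u} [Field k] [Ring A] [Algebra k A] [Ring B] [Algebra k B] :
    CoeSort (FDBimodule k A B) (Type u) := ⟨FDBimodule.carrier⟩

attribute [instance] addCommGroup module leftModule rightModule leftTower rightTower smulComm finite

/-- `P` is projective as an `A`-`B`-bimodule, that is, as a left module over `A ⊗ Bᵐᵒᵖ`. -/
def IsProjective {k : Type w} {A B : Type u} [Field k] [Ring A] [Algebra k A] [Ring B]
    [Algebra k B] (P : FDBimodule k A B) : Prop :=
  letI : Module (A ⊗[k] Bᵐᵒᵖ) P := TensorProduct.Algebra.module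
  Module.Projective (A ⊗[k] Bᵐᵒᵖ) P

/-- `M ⊗_B N ≅ A ⊕ P` as `A`-`A`-bimodules for some projective `A`-`A`-bimodule `P`. -/
def TensorIsoRegularSumProjective {k : Type w} {A B : Type u} [Field k] [Ring A] [Algebra k A]
    [Ring B] [Algebra k B] (M : FDBimodule k A B) (N : FDBimodule k B A) : Prop :=
  ∃ P : FDBimodule k A A, P.IsProjective ∧
    ∃ e : BalancedTensor B M N ≃+ A × P,
      (∀ (a : A) (x : BalancedTensor B M N), e (a • x) = a • e x) ∧
      (∀ (a : A) (x : BalancedTensor B M N), e (op a • x) = op a • e x)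

/-- `M` and `N` define a stable equivalence of Morita type between `A` and `B`. -/
structure DefineStableEquivalence {k : Type w} {A B : Type u} [Field k] [Ring A] [Algebra k A]
    [Ring B] [Algebra k B] (M : FDBimodule k A B) (N : FDBimodule k B A) : Prop where
  projective_left_M : Module.Projective A M
  projective_right_M : Module.Projective Bᵐᵒᵖ M
  projective_left_N : Module.Projective B N
  projective_right_N : Module.Projective Aᵐᵒᵖ N
  tensor_M_N : TensorIsoRegularSumProjective M N
  tensor_N_M : TensorIsoRegularSumProjective N M

end FDBimodule

/-- `A` and `B` are stably equivalent of Morita type. -/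
def StablyEquivalentOfMoritaType (k : Type w) (A B : Type u) [Field k] [Ring A] [Algebra k A]
    [Ring B] [Algebra k B] : Prop :=
  ∃ (M : FDBimodule k A B) (N : FDBimodule k B A), M.DefineStableEquivalence N

/-! ### Separable algebras -/

/-- The `k`-algebra `S` is separable: it is projective as an `S`-`S`-bimodule. -/
def IsSeparableAlgebra (k : Type w) (S : Type u) [Field k] [Ring S] [Algebra k S] : Prop :=
  letI : Module (S ⊗[k] Sᵐᵒᵖ) S := instModuleTensorProductMop k S
  Module.Projective (S ⊗[k] Sᵐᵒᵖ) S

/-- `A` has no (nonzero) separable direct summand as a `k`-algebra. -/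
def HasNoSeparableSummand (k : Type w) (A : Type u) [Field k] [Ring A] [Algebra k A] : Prop :=
  ∀ (S C : Type u) [Ring S] [Algebra k S] [Ring C] [Algebra k C],
    Nonempty (A ≃ₐ[k] S × C) → IsSeparableAlgebra k S → Subsingleton S

/-! ### Cluster tilting modules -/

/-- `X` belongs to `add T`: it is a direct summand of a finite direct sum of copies of `T`. -/
def InAdd (A : Type u) [Ring A] (T X : Type u) [AddCommGroup T] [Module A T]
    [AddCommGroup X] [Module A X] : Prop :=
  ∃ (m : ℕ) (i : X →ₗ[A] (Fin m → T)) (r : (Fin m → T) →ₗ[A] X), r ∘ₗ i = LinearMap.id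

/-- `Extⁱ_A(X, Y) = 0` for all `1 ≤ i < n`. -/
def ExtVanishes (n : ℕ) (A : Type u) [Ring A] (X Y : Type u) [AddCommGroup X] [Module A X]
    [AddCommGroup Y] [Module A Y] : Prop :=
  ∀ i : ℕ, 1 ≤ i → i < n →
    Subsingleton (Abelian.Ext.{u} (ModuleCat.of A X) (ModuleCat.of A Y) i)

/-- The left `A`-module `T` is an `n`-cluster tilting module: it is finitely generated, and, among
finitely generated `A`-modules `X`, the membership `X ∈ add T` is equivalent to each of the
conditions `Extⁱ(X, T) = 0` for `1 ≤ i < n` and `Extⁱ(T, X) = 0` for `1 ≤ i < n`. -/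
structure IsClusterTilting (n : ℕ) (A : Type u) [Ring A] (T : Type u) [AddCommGroup T]
    [Module A T] : Prop where
  finite : Module.Finite A T
  mem_add_iff_left : ∀ (X : Type u) [AddCommGroup X] [Module A X] [Module.Finite A X],
    InAdd A T X ↔ ExtVanishes n A X T
  mem_add_iff_right : ∀ (X : Type u) [AddCommGroup X] [Module A X] [Module.Finite A X],
    InAdd A T X ↔ ExtVanishes n A T X

/-- The (left) global dimension of `A` is at most `n`. -/
def GlobalDimensionLE (A : Type u) [Ring A] (n : ℕ) : Prop :=
  ∀ X : ModuleCat.{u} A, HasProjectiveDimensionLE X n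

/-- `A` is `n`-representation-finite: it has an `n`-cluster tilting module and, if `2 ≤ n`, its
global dimension is at most `n`. (Used for `1 ≤ n`.) -/
structure IsRepresentationFinite (n : ℕ) (A : Type u) [Ring A] : Prop where
  globalDimension : 2 ≤ n → GlobalDimensionLE A n
  exists_clusterTilting : ∃ (T : Type u) (_ : AddCommGroup T) (_ : Module A T),
    IsClusterTilting n A T

/-!
Let `F = N ⊗_A -` and `G = M ⊗_B -`. Both functors are exact and preserve projective modules and
finitely generated modules, because `M` and `N` are finite-dimensional and projective on either
side. Associativity of the tensor product and the isomorphism `M ⊗_B N ≃ A ⊕ P` give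
`G (F X) ≃ X ⊕ P ⊗_A X`, naturally in `X`, and `P ⊗_A X` is projective because
`(A ⊗[k] Aᵐᵒᵖ) ⊗_A X` is the free `A`-module `A ⊗[k] X`; similarly for `F (G Y)`. The structure
`HasLeftInverseUpToProjectives` records these properties of `F` relative to `G`, and the theorem
holds for every pair of functors that satisfies it in both orders.

Since the identity is naturally a retract of `G F`, the functor `F` reflects the vanishing of `Ext`
in positive degrees (`CategoryTheory.Functor.subsingleton_ext_of_map`), and so does `G`; this gives
the statement on global dimensions at once.

Let `T` be `n`-cluster tilting over `A`; all extensions below are in degrees strictly between `0`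
and `n`. Finitely generated projective `A`-modules lie in `add T`, so `G (F T)` lies in `add T` and
has no self-extensions; reflecting along `G`, neither has `F T`. A `B`-module `X` with `G X` in
`add T` lies in `add (F T)`, as it is a summand of `F (G X)`; in particular `add (F T)` contains the
finitely generated projective `B`-modules. If `X` is finitely generated and `Ext (X, F T)` or
`Ext (F T, X)` vanishes, then the same is true with `F (G X)` in place of `X`, this being the direct
sum of `X` and a projective module in `add (F T)`. Reflecting along `F`, `Ext (G X, T)` or
`Ext (T, G X)` vanishes, so that `G X` lies in `add T` and `X` lies in `add (F T)`; see
`HasLeftInverseUpToProjectives.isClusterTilting_obj`.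
-/

/-! ### Exact functors that reflect the vanishing of extensions -/

section ReflectExt

open Limits Abelian

universe v₁ v₂ u₁ u₂ w₁ w₂

variable {C : Type u₁} [Category.{v₁} C] [Abelian C] [HasExt.{w₁} C]
  {D : Type u₂} [Category.{v₂} D] [Abelian D] [HasExt.{w₂} D]

theorem CategoryTheory.Abelian.Ext.subsingleton_one_of_extend {S : ShortComplex C}
    (hS : S.ShortExact) [Projective S.X₂] {Y : C}
    (h : ∀ f : S.X₁ ⟶ Y, ∃ g : S.X₂ ⟶ Y, S.f ≫ g = f) : Subsingleton (Ext S.X₃ Y 1) := by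
  refine subsingleton_of_forall_eq 0 fun e => ?_
  obtain ⟨f, rfl⟩ := contravariant_sequence_exact₃ hS Y e (eq_zero_of_projective _) (add_zero 1)
  obtain ⟨f, rfl⟩ := (mk₀_bijective _ _).2 f
  obtain ⟨g, rfl⟩ := h f
  rw [← mk₀_comp_mk₀, hS.extClass_comp_assoc]

theorem CategoryTheory.ShortComplex.ShortExact.exists_extend_of_subsingleton_ext_one
    {S : ShortComplex C} (hS : S.ShortExact) {Y : C} [Subsingleton (Ext S.X₃ Y 1)]
    (f : S.X₁ ⟶ Y) : ∃ g : S.X₂ ⟶ Y, S.f ≫ g = f := by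
  obtain ⟨g, hg⟩ := Ext.contravariant_sequence_exact₁ hS Y (Ext.mk₀ f) (add_zero 1)
    (Subsingleton.elim _ _)
  obtain ⟨g, rfl⟩ := (Ext.mk₀_bijective _ _).2 g
  exact ⟨g, (Ext.mk₀_bijective _ _).1 (by rw [← Ext.mk₀_comp_mk₀, hg])⟩

/-- Dimension shifting along a short exact sequence with projective middle term. -/
theorem CategoryTheory.ShortComplex.ShortExact.subsingleton_ext_succ_iff
    {S : ShortComplex C} (hS : S.ShortExact) [Projective S.X₂] (Y : C) (n : ℕ) :
    Subsingleton (Ext S.X₃ Y (n + 2)) ↔ Subsingleton (Ext S.X₁ Y (n + 1)) := by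
  constructor
  · intro _
    refine subsingleton_of_forall_eq 0 fun e => ?_
    obtain ⟨e, rfl⟩ := Ext.contravariant_sequence_exact₁ hS Y e (n₁ := n + 2) (by omega)
      (Subsingleton.elim _ _)
    rw [e.eq_zero_of_projective, Ext.comp_zero]
  · intro _
    refine subsingleton_of_forall_eq 0 fun e => ?_
    obtain ⟨e, rfl⟩ := Ext.contravariant_sequence_exact₃ hS Y e (Ext.eq_zero_of_projective _)
      (n₀ := n + 1) (by omega)
    rw [Subsingleton.elim e 0, Ext.comp_zero]

/-- An exact functor `F` preserving projective objects, such that the identity functor is a retract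
of `F ⋙ G` for some `G`, reflects the vanishing of `Ext` in positive degrees. In degree one, a map
from a syzygy of `X` to `Y` is extended to the projective after applying `F`; applying `G` and
the retraction brings the extension back. -/
theorem CategoryTheory.Functor.subsingleton_ext_of_map [EnoughProjectives C] (F : C ⥤ D)
    [F.Additive] [PreservesFiniteLimits F] [PreservesFiniteColimits F]
    [F.PreservesProjectiveObjects] {G : D ⥤ C} (r : Retract (𝟭 C) (F ⋙ G)) (n : ℕ) :
    ∀ X Y : C, Subsingleton (Ext (F.obj X) (F.obj Y) (n + 1)) → Subsingleton (Ext X Y (n + 1)) := by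
  have key (X : C) : ∃ (S : ShortComplex C), S.ShortExact ∧ Projective S.X₂ ∧ S.X₃ = X :=
    ⟨ShortComplex.mk (kernel.ι (Projective.π X)) (Projective.π X) (kernel.condition _),
      { exact := ShortComplex.exact_kernel _
        mono_f := by dsimp; infer_instance
        epi_g := by dsimp; infer_instance },
      by dsimp; infer_instance, rfl⟩
  induction n with
  | zero =>
    intro X Y h
    obtain ⟨S, hS, _, rfl⟩ := key X
    have hFS := hS.map_of_exact F
    refine Ext.subsingleton_one_of_extend hS fun f => ?_
    have : Subsingleton (Ext (S.map F).X₃ (F.obj Y) 1) := h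
    obtain ⟨g, hg⟩ := hFS.exists_extend_of_subsingleton_ext_one (F.map f)
    -- The extension is `S.X₂ ⟶ G (F S.X₂) ⟶ G (F Y) ⟶ Y`; it restricts to `f` by naturality.
    refine ⟨r.i.app S.X₂ ≫ G.map g ≫ r.r.app Y, ?_⟩
    have h1 := r.i.naturality_assoc S.f (G.map g ≫ r.r.app Y)
    have h2 := congrArg G.map hg
    rw [G.map_comp] at h2
    have h3 := r.i.naturality_assoc f (r.r.app Y)
    have h4 := congr_app r.retract Y
    simp only [Functor.id_map, Functor.comp_map, NatTrans.comp_app, NatTrans.id_app] at h1 h3 h4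
    rw [h1]
    change _ ≫ G.map (F.map S.f) ≫ _ = _
    rw [reassoc_of% (show G.map (F.map S.f) ≫ G.map g = G.map (F.map f) from h2), ← h3, h4]
    exact Category.comp_id f
  | succ n ih =>
    intro X Y h
    obtain ⟨S, hS, _, rfl⟩ := key X
    have : Projective (S.map F).X₂ := F.projective_obj_of_projective ‹_›
    rw [hS.subsingleton_ext_succ_iff]
    exact ih _ _ (((hS.map_of_exact F).subsingleton_ext_succ_iff _ _).1 h)

end ReflectExt

/-! ### Additive closures and extensions in abelian categories -/

section AddClosure

open Limits Abelian

universe v₁ v₂ u₁ u₂ w₁ w₂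

/-- The object `X` belongs to the additive closure of `T`: its identity is a finite sum of
endomorphisms that factor through `T`. -/
def CategoryTheory.InAddClosure {C : Type u₁} [Category.{v₁} C] [Preadditive C] (T X : C) : Prop :=
  ∃ (J : Type) (_ : Fintype J) (i : J → (X ⟶ T)) (r : J → (T ⟶ X)), ∑ j, i j ≫ r j = 𝟙 X

namespace CategoryTheory.InAddClosure

variable {C : Type u₁} [Category.{v₁} C] [Preadditive C] {D : Type u₂} [Category.{v₂} D]
  [Preadditive D]

theorem of_retract {T X : C} (r : Retract X T) : InAddClosure T X :=
  ⟨Unit, inferInstance, fun _ => r.i, fun _ => r.r, by simp⟩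

theorem trans {T X Y : C} (h : InAddClosure T X) (h' : InAddClosure X Y) : InAddClosure T Y := by
  obtain ⟨J, _, i, r, hir⟩ := h
  obtain ⟨J', _, i', r', hir'⟩ := h'
  refine ⟨J' × J, inferInstance, fun p => i' p.1 ≫ i p.2, fun p => r p.2 ≫ r' p.1, ?_⟩
  rw [Fintype.sum_prod_type, ← hir']
  refine Finset.sum_congr rfl fun j _ => ?_
  calc ∑ l, (i' j ≫ i l) ≫ r l ≫ r' j = i' j ≫ (∑ l, i l ≫ r l) ≫ r' j := by
        simp [Preadditive.sum_comp, Preadditive.comp_sum]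
    _ = i' j ≫ r' j := by rw [hir, Category.id_comp]

theorem map {T X : C} (h : InAddClosure T X) (F : C ⥤ D) [F.Additive] :
    InAddClosure (F.obj T) (F.obj X) := by
  obtain ⟨J, _, i, r, hir⟩ := h
  exact ⟨J, inferInstance, fun j => F.map (i j), fun j => F.map (r j), by
    simp only [← F.map_comp, ← F.map_sum, hir, F.map_id]⟩

/-- An object whose identity is a sum of two maps factoring through objects of an additive closure
belongs to that closure. -/
theorem of_add {T X Y Z : C} (hX : InAddClosure T X) (hY : InAddClosure T Y) {a : Z ⟶ X} {b : X ⟶ Z}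
    {c : Z ⟶ Y} {d : Y ⟶ Z} (h : a ≫ b + c ≫ d = 𝟙 Z) : InAddClosure T Z := by
  obtain ⟨J, _, i, r, hir⟩ := hX
  obtain ⟨J', _, i', r', hir'⟩ := hY
  refine ⟨J ⊕ J', inferInstance, Sum.elim (fun j => a ≫ i j) (fun j => c ≫ i' j),
    Sum.elim (fun j => r j ≫ b) (fun j => r' j ≫ d), ?_⟩
  rw [Fintype.sum_sum_type, ← h]
  congr 1
  · calc _ = a ≫ (∑ l, i l ≫ r l) ≫ b := by simp [Preadditive.sum_comp, Preadditive.comp_sum]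
      _ = a ≫ b := by rw [hir, Category.id_comp]
  · calc _ = c ≫ (∑ l, i' l ≫ r' l) ≫ d := by simp [Preadditive.sum_comp, Preadditive.comp_sum]
      _ = c ≫ d := by rw [hir', Category.id_comp]

end CategoryTheory.InAddClosure

namespace CategoryTheory.Abelian.Ext

variable {C : Type u₁} [Category.{v₁} C] [Abelian C] [HasExt.{w₁} C]

theorem subsingleton_of_inAddClosure_left {T X Y : C} (h : InAddClosure T X) (n : ℕ)
    [Subsingleton (Ext T Y n)] : Subsingleton (Ext X Y n) := by
  obtain ⟨J, _, i, r, hir⟩ := h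
  refine subsingleton_of_forall_eq 0 fun e => ?_
  rw [← mk₀_id_comp e, ← hir, mk₀_sum, sum_comp]
  refine Finset.sum_eq_zero fun j _ => ?_
  rw [← mk₀_comp_mk₀_assoc, Subsingleton.elim ((mk₀ (r j)).comp e _) 0, comp_zero]

theorem subsingleton_of_inAddClosure_right {T X Y : C} (h : InAddClosure T X) (n : ℕ)
    [Subsingleton (Ext Y T n)] : Subsingleton (Ext Y X n) := by
  obtain ⟨J, _, i, r, hir⟩ := h
  refine subsingleton_of_forall_eq 0 fun e => ?_
  rw [← comp_mk₀_id e, ← hir, mk₀_sum, comp_sum]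
  refine Finset.sum_eq_zero fun j _ => ?_
  rw [← mk₀_comp_mk₀, ← comp_assoc_of_second_deg_zero, Subsingleton.elim (e.comp (mk₀ (i j)) _) 0,
    zero_comp]

/-- If the identity of `Z` is a sum of two maps factoring through `X` and `W`, then `Ext` out of `Z`
vanishes when it vanishes out of `X` and of `W`. -/
theorem subsingleton_of_add_left {X W Y Z : C} {a : Z ⟶ X} {b : X ⟶ Z} {c : Z ⟶ W} {d : W ⟶ Z}
    (h : a ≫ b + c ≫ d = 𝟙 Z) (n : ℕ) [Subsingleton (Ext X Y n)] [Subsingleton (Ext W Y n)] :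
    Subsingleton (Ext Z Y n) := by
  refine subsingleton_of_forall_eq 0 fun e => ?_
  rw [← mk₀_id_comp e, ← h, mk₀_add, add_comp, ← mk₀_comp_mk₀_assoc, ← mk₀_comp_mk₀_assoc,
    Subsingleton.elim ((mk₀ b).comp e _) 0, Subsingleton.elim ((mk₀ d).comp e _) 0, comp_zero,
    comp_zero, add_zero]

theorem subsingleton_of_add_right {X W Y Z : C} {a : Z ⟶ X} {b : X ⟶ Z} {c : Z ⟶ W} {d : W ⟶ Z}
    (h : a ≫ b + c ≫ d = 𝟙 Z) (n : ℕ) [Subsingleton (Ext Y X n)] [Subsingleton (Ext Y W n)] :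
    Subsingleton (Ext Y Z n) := by
  refine subsingleton_of_forall_eq 0 fun e => ?_
  rw [← comp_mk₀_id e, ← h, mk₀_add, comp_add, ← mk₀_comp_mk₀, ← mk₀_comp_mk₀,
    ← comp_assoc_of_second_deg_zero, ← comp_assoc_of_second_deg_zero,
    Subsingleton.elim (e.comp (mk₀ a) _) 0, Subsingleton.elim (e.comp (mk₀ c) _) 0, zero_comp,
    zero_comp, add_zero]

end CategoryTheory.Abelian.Ext

end AddClosure

/-! ### Transfer of cluster tilting modules along a pair of functors -/

section Transfer

open Limits Abelian

variable {A B : Type u} [Ring A] [Ring B]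

theorem inAdd_iff_inAddClosure {T X : ModuleCat.{u} A} : InAdd A T X ↔ InAddClosure T X := by
  constructor
  · rintro ⟨m, i, r, h⟩
    refine ⟨Fin m, inferInstance, fun j => ModuleCat.ofHom (LinearMap.proj j ∘ₗ i),
      fun j => ModuleCat.ofHom (r ∘ₗ LinearMap.single A (fun _ => T) j), ?_⟩
    ext x
    have h' := LinearMap.congr_fun h x
    simp only [LinearMap.comp_apply, LinearMap.id_apply] at h'
    rw [ModuleCat.hom_sum]
    simp only [ModuleCat.hom_comp, ModuleCat.hom_ofHom, LinearMap.coe_sum, Finset.sum_apply,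
      LinearMap.comp_apply, LinearMap.proj_apply, LinearMap.single_apply, ModuleCat.hom_id,
      LinearMap.id_apply, ← map_sum, LinearMap.sum_single_apply]
    exact h'
  · rintro ⟨J, _, i, r, h⟩
    let ε := Fintype.equivFin J
    refine ⟨Fintype.card J, LinearMap.pi fun j => (i (ε.symm j)).hom,
      ∑ j, (r (ε.symm j)).hom ∘ₗ LinearMap.proj j, ?_⟩
    ext x
    have h' := LinearMap.congr_fun (congrArg ModuleCat.Hom.hom h) x
    rw [ModuleCat.hom_sum] at h'
    simp only [LinearMap.coe_sum, Finset.sum_apply, ModuleCat.hom_comp, LinearMap.comp_apply] at h'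
    simp only [LinearMap.coe_sum, Finset.sum_apply, LinearMap.comp_apply, LinearMap.pi_apply,
      LinearMap.proj_apply, LinearMap.id_apply]
    rw [Equiv.sum_comp ε.symm fun j => (r j).hom ((i j).hom x)]
    exact h'

/-- The functor `F` between module categories is exact, preserves projective and finitely generated
modules, and has `G` as a left inverse up to projective summands: the identity functor is a retract
of `F ⋙ G`, and every `G (F X)` decomposes into `X` and a projective module `W`, which is finitely
generated if `X` is. Of the decomposition only the relation `a ≫ b + c ≫ d = 𝟙` between the
projections `a`, `c` and the inclusions `b`, `d` is recorded; it makes `G (F X)` a direct summand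
of `X ⊕ W`. -/
structure HasLeftInverseUpToProjectives (F : ModuleCat.{u} A ⥤ ModuleCat.{u} B)
    (G : ModuleCat.{u} B ⥤ ModuleCat.{u} A) : Prop where
  additive : F.Additive
  preservesFiniteLimits : PreservesFiniteLimits F
  preservesFiniteColimits : PreservesFiniteColimits F
  preservesProjectiveObjects : F.PreservesProjectiveObjects
  finite_obj (X : ModuleCat.{u} A) : Module.Finite A X → Module.Finite B (F.obj X)
  retract : Nonempty (Retract (𝟭 _) (F ⋙ G))
  decomposition (X : ModuleCat.{u} A) : ∃ (W : ModuleCat.{u} A) (a : G.obj (F.obj X) ⟶ X)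
    (b : X ⟶ G.obj (F.obj X)) (c : G.obj (F.obj X) ⟶ W) (d : W ⟶ G.obj (F.obj X)),
    a ≫ b + c ≫ d = 𝟙 _ ∧ Projective W ∧ (Module.Finite A X → Module.Finite A W)

namespace IsClusterTilting

variable {n : ℕ} {T : ModuleCat.{u} A}

theorem inAddClosure_of_projective (hT : IsClusterTilting n A T) (X : ModuleCat.{u} A)
    [Projective X] [Module.Finite A X] : InAddClosure T X := by
  rw [← inAdd_iff_inAddClosure, hT.mem_add_iff_left]
  intro i hi _
  obtain ⟨i, rfl⟩ := Nat.exists_eq_add_of_le' hi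
  exact Ext.subsingleton_of_projective (P := X) T i

theorem extVanishes_self (hT : IsClusterTilting n A T) : ExtVanishes n A T T :=
  have := hT.finite
  (hT.mem_add_iff_left T).1 (inAdd_iff_inAddClosure.2 (.of_retract (.refl _)))

end IsClusterTilting

namespace HasLeftInverseUpToProjectives

variable {F : ModuleCat.{u} A ⥤ ModuleCat.{u} B} {G : ModuleCat.{u} B ⥤ ModuleCat.{u} A}

theorem extVanishes_of_map (hF : HasLeftInverseUpToProjectives F G) {n : ℕ} {X Y : ModuleCat.{u} A}
    (h : ExtVanishes n B (F.obj X) (F.obj Y)) : ExtVanishes n A X Y := by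
  intro i hi hin
  obtain ⟨i, rfl⟩ := Nat.exists_eq_add_of_le' hi
  obtain ⟨r⟩ := hF.retract
  have := hF.additive
  have := hF.preservesFiniteLimits
  have := hF.preservesFiniteColimits
  have := hF.preservesProjectiveObjects
  exact F.subsingleton_ext_of_map r i X Y (h _ hi hin)

theorem globalDimensionLE (hG : HasLeftInverseUpToProjectives G F) {n : ℕ}
    (h : GlobalDimensionLE A n) : GlobalDimensionLE B n := by
  intro X
  rw [HasProjectiveDimensionLE, hasProjectiveDimensionLT_iff.{u}]
  intro i hi Y e
  obtain ⟨i, rfl⟩ := Nat.exists_eq_add_of_le' (Nat.le_of_add_left_le hi)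
  obtain ⟨r⟩ := hG.retract
  have := hG.additive
  have := hG.preservesFiniteLimits
  have := hG.preservesFiniteColimits
  have := hG.preservesProjectiveObjects
  have := h (G.obj X)
  have := G.subsingleton_ext_of_map r i X Y
    (HasProjectiveDimensionLT.subsingleton (G.obj X) (n + 1) _ hi _)
  exact Subsingleton.elim _ _

/-- The functor `F` sends cluster tilting modules to cluster tilting modules. Since `G (F T)` lies
in `add T` and `G` reflects vanishing of extensions, `F T` has no self-extensions; and if `X` has no
extensions with `F T` on one side, then neither has `F (G X)`, because projectives lie in
`add (F T)`, whence `G X` lies in `add T` and `X`, a summand of `F (G X)`, lies in `add (F T)`. -/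
theorem isClusterTilting_obj (hF : HasLeftInverseUpToProjectives F G)
    (hG : HasLeftInverseUpToProjectives G F) {n : ℕ} {T : ModuleCat.{u} A}
    (hT : IsClusterTilting n A T) : IsClusterTilting n B (F.obj T) := by
  have hTfin := hT.finite
  have := hF.additive
  have := hG.additive
  have hadd_obj (X : ModuleCat.{u} B) (h : InAddClosure T (G.obj X)) :
      InAddClosure (F.obj T) X := by
    obtain ⟨r⟩ := hG.retract
    exact (h.map F).trans (.of_retract ⟨r.i.app X, r.r.app X, congr_app r.retract X⟩)
  have hproj (X : ModuleCat.{u} B) (_ : Projective X) (_ : Module.Finite B X) :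
      InAddClosure (F.obj T) X := by
    have := hG.preservesProjectiveObjects
    have : Projective (G.obj X) := G.projective_obj_of_projective ‹_›
    have := hG.finite_obj X ‹_›
    exact hadd_obj X (hT.inAddClosure_of_projective _)
  have hself : ExtVanishes n B (F.obj T) (F.obj T) := by
    refine hG.extVanishes_of_map fun i hi hin => ?_
    obtain ⟨W, a, b, c, d, h, _, hW⟩ := hF.decomposition T
    have := hW hTfin
    have hmem : InAddClosure T (G.obj (F.obj T)) :=
      .of_add (.of_retract (.refl _)) (hT.inAddClosure_of_projective W) h
    have : Subsingleton (Ext.{u} T T i) := hT.extVanishes_self i hi hin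
    have : Subsingleton (Ext.{u} T (G.obj (F.obj T)) i) :=
      Ext.subsingleton_of_inAddClosure_right hmem i
    exact Ext.subsingleton_of_inAddClosure_left hmem i
  refine ⟨hF.finite_obj T hTfin, fun X _ _ _ => ⟨fun h i hi hin => ?_, fun h => ?_⟩,
    fun X _ _ _ => ⟨fun h i hi hin => ?_, fun h => ?_⟩⟩
  · have : Subsingleton (Ext.{u} (F.obj T) (F.obj T) i) := hself i hi hin
    exact Ext.subsingleton_of_inAddClosure_left
      (inAdd_iff_inAddClosure (X := ModuleCat.of B X).1 h) i
  · refine inAdd_iff_inAddClosure.2 (hadd_obj (ModuleCat.of B X) (inAdd_iff_inAddClosure.1 ?_))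
    have := hG.finite_obj (ModuleCat.of B X) ‹_›
    refine (hT.mem_add_iff_left _).2 (hF.extVanishes_of_map fun i hi hin => ?_)
    obtain ⟨W, a, b, c, d, hZ, _, -⟩ := hG.decomposition (ModuleCat.of B X)
    have : Subsingleton (Ext.{u} (ModuleCat.of B X) (F.obj T) i) := h i hi hin
    have : Subsingleton (Ext.{u} W (F.obj T) i) := by
      obtain ⟨i, rfl⟩ := Nat.exists_eq_add_of_le' hi
      exact Ext.subsingleton_of_projective (P := W) (F.obj T) i
    exact Ext.subsingleton_of_add_left hZ i
  · have : Subsingleton (Ext.{u} (F.obj T) (F.obj T) i) := hself i hi hin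
    exact Ext.subsingleton_of_inAddClosure_right
      (inAdd_iff_inAddClosure (X := ModuleCat.of B X).1 h) i
  · refine inAdd_iff_inAddClosure.2 (hadd_obj (ModuleCat.of B X) (inAdd_iff_inAddClosure.1 ?_))
    have := hG.finite_obj (ModuleCat.of B X) ‹_›
    refine (hT.mem_add_iff_right _).2 (hF.extVanishes_of_map fun i hi hin => ?_)
    obtain ⟨W, a, b, c, d, hZ, _, hW⟩ := hG.decomposition (ModuleCat.of B X)
    have : Subsingleton (Ext.{u} (F.obj T) (ModuleCat.of B X) i) := h i hi hin
    have : Subsingleton (Ext.{u} (F.obj T) (F.obj T) i) := hself i hi hin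
    have : Subsingleton (Ext.{u} (F.obj T) W i) :=
      Ext.subsingleton_of_inAddClosure_right (hproj W ‹_› (hW ‹_›)) i
    exact Ext.subsingleton_of_add_right hZ i

end HasLeftInverseUpToProjectives

end Transfer

/-! ### Maps out of balanced tensor products and associativity -/

namespace BalancedTensor

section Lift

variable {R X Y : Type u} [Ring R] [AddCommGroup X] [Module Rᵐᵒᵖ X] [AddCommGroup Y] [Module R Y]

/-- The additive map out of the tensor product induced by a balanced biadditive map. -/
def lift {G : Type*} [AddCommGroup G] (f : X →+ Y →+ G)
    (hf : ∀ x (r : R) y, f (op r • x) y = f x (r • y)) : BalancedTensor R X Y →+ G :=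
  QuotientAddGroup.lift (balancedRelations R X Y)
    (TensorProduct.liftAddHom f fun r x y => by simp) (by
      rw [balancedRelations, AddSubgroup.closure_le]
      rintro _ ⟨x, r, y, rfl⟩
      simp [hf])

@[simp]
theorem lift_tmul {G : Type*} [AddCommGroup G] (f : X →+ Y →+ G)
    (hf : ∀ x (r : R) y, f (op r • x) y = f x (r • y)) (x : X) (y : Y) :
    lift f hf (tmul R x y) = f x y := rfl

theorem induction_on {p : BalancedTensor R X Y → Prop} (z : BalancedTensor R X Y) (zero : p 0)
    (tmul : ∀ x y, p (tmul R x y)) (add : ∀ z z', p z → p z' → p (z + z')) : p z := by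
  obtain ⟨z, rfl⟩ := QuotientAddGroup.mk'_surjective (balancedRelations R X Y) z
  induction z with
  | zero => exact zero
  | tmul x y => exact tmul x y
  | add a b ha hb => exact add _ _ ha hb

theorem sum_tmul {ι : Type*} (s : Finset ι) (x : ι → X) (y : Y) :
    tmul R (∑ j ∈ s, x j) y = ∑ j ∈ s, tmul R (x j) y :=
  map_sum (⟨⟨fun x => tmul R x y, zero_tmul R y⟩, fun _ _ => add_tmul R _ _ _⟩ : X →+ _) x s

theorem tmul_sum {ι : Type*} (s : Finset ι) (x : X) (y : ι → Y) :
    tmul R x (∑ j ∈ s, y j) = ∑ j ∈ s, tmul R x (y j) :=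
  map_sum (⟨⟨fun y => tmul R x y, tmul_zero R x⟩, fun _ _ => tmul_add R _ _ _⟩ : Y →+ _) y s

/-- The map `y ↦ (x ↦ x ⊗ y)`. -/
def tmulRight (S : Type*) [Ring S] [Module S X] [SMulCommClass S Rᵐᵒᵖ X] :
    Y →+ X →ₗ[S] BalancedTensor R X Y where
  toFun y :=
    { toFun := fun x => tmul R x y
      map_add' := fun _ _ => add_tmul R _ _ y
      map_smul' := fun _ _ => rfl }
  map_zero' := LinearMap.ext fun x => tmul_zero R x
  map_add' _ _ := LinearMap.ext fun x => tmul_add R x _ _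

/-- The map `x ↦ (y ↦ x ⊗ y)`. -/
def tmulLeft (S : Type*) [Ring S] [Module Sᵐᵒᵖ Y] [SMulCommClass R Sᵐᵒᵖ Y] :
    X →+ Y →ₗ[Sᵐᵒᵖ] BalancedTensor R X Y where
  toFun x :=
    { toFun := fun y => tmul R x y
      map_add' := fun _ _ => tmul_add R x _ _
      map_smul' := fun _ _ => rfl }
  map_zero' := LinearMap.ext fun y => zero_tmul R y
  map_add' _ _ := LinearMap.ext fun y => add_tmul R _ _ y

instance smulCommClass (S S' : Type*) [Ring S] [Module S X] [SMulCommClass S Rᵐᵒᵖ X]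
    [Ring S'] [Module S'ᵐᵒᵖ Y] [SMulCommClass R S'ᵐᵒᵖ Y] :
    SMulCommClass S S'ᵐᵒᵖ (BalancedTensor R X Y) where
  smul_comm s t z := by
    induction z using induction_on with
    | zero => simp only [smul_zero]
    | tmul x y => rfl
    | add z z' h h' => simp only [smul_add, h, h']

/-- Elements `x ⊗ y` with `x` in a set of left module generators of `X` and `y` in a set of
generators of `Y` generate `X ⊗ Y`. -/
theorem finite (S : Type*) [Ring S] [Module S X] [SMulCommClass S Rᵐᵒᵖ X] [Module.Finite S X]
    [Module.Finite R Y] : Module.Finite S (BalancedTensor R X Y) := by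
  obtain ⟨m, x, hx⟩ := Module.Finite.exists_fin (R := S) (M := X)
  obtain ⟨l, y, hy⟩ := Module.Finite.exists_fin (R := R) (M := Y)
  have hx' (t : X) (j : Fin l) : tmul R t (y j) ∈ Submodule.span S
      (Set.range fun p : Fin m × Fin l => tmul R (x p.1) (y p.2)) := by
    have ht : t ∈ Submodule.span S (Set.range x) := hx ▸ Submodule.mem_top
    induction ht using Submodule.span_induction with
    | mem t ht => obtain ⟨i, rfl⟩ := ht; exact Submodule.subset_span ⟨(i, j), rfl⟩
    | zero => rw [zero_tmul]; exact zero_mem _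
    | add _ _ _ _ h h' => rw [add_tmul]; exact add_mem h h'
    | smul s _ _ h => rw [← smul_tmul]; exact Submodule.smul_mem _ _ h
  have hxy (t : X) (v : Y) : tmul R t v ∈ Submodule.span S
      (Set.range fun p : Fin m × Fin l => tmul R (x p.1) (y p.2)) := by
    have hv : v ∈ Submodule.span R (Set.range y) := hy ▸ Submodule.mem_top
    induction hv using Submodule.span_induction generalizing t with
    | mem v hv => obtain ⟨j, rfl⟩ := hv; exact hx' t j
    | zero => rw [tmul_zero]; exact zero_mem _
    | add _ _ _ _ h h' => rw [tmul_add]; exact add_mem (h t) (h' t)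
    | smul r _ _ h => rw [← tmul_balanced]; exact h _
  refine ⟨Submodule.fg_def.2 ⟨_, Set.finite_range fun p : Fin m × Fin l => tmul R (x p.1) (y p.2),
    eq_top_iff.2 fun z _ => ?_⟩⟩
  induction z using induction_on with
  | zero => exact zero_mem _
  | tmul t v => exact hxy t v
  | add _ _ h h' => exact add_mem (h trivial) (h' trivial)

end Lift

section Functor

/-- The functor `N ⊗_R -` from left `R`-modules to left `S`-modules given by a bimodule. -/
def functor (S R N : Type u) [Ring S] [Ring R] [AddCommGroup N] [Module S N] [Module Rᵐᵒᵖ N]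
    [SMulCommClass S Rᵐᵒᵖ N] : ModuleCat.{u} R ⥤ ModuleCat.{u} S where
  obj X := ModuleCat.of S (BalancedTensor R N X)
  map f := ModuleCat.ofHom
    { map LinearMap.id f.hom with
      map_smul' := fun s z => by
        induction z using induction_on with
        | zero => simp
        | tmul x y => rfl
        | add z z' h h' => simp_all }
  map_id X := by
    ext z
    exact DFunLike.congr_fun (hom_ext (f := map LinearMap.id LinearMap.id)
      (g := AddMonoidHom.id _) fun _ _ => rfl) z
  map_comp {X Y Z} f g := by
    ext z
    exact DFunLike.congr_fun (hom_ext (f := map (LinearMap.id : N →ₗ[Rᵐᵒᵖ] N) (f ≫ g).hom)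
      (g := (map LinearMap.id g.hom).comp (map LinearMap.id f.hom)) fun _ _ => rfl) z

variable {S R N : Type u} [Ring S] [Ring R] [AddCommGroup N] [Module S N] [Module Rᵐᵒᵖ N]
    [SMulCommClass S Rᵐᵒᵖ N]

theorem functor_obj_hom_ext {X : ModuleCat.{u} R} {Y : ModuleCat.{u} S}
    {f g : (functor S R N).obj X ⟶ Y}
    (h : ∀ (n : N) (x : X), f.hom (tmul R n x : BalancedTensor R N X) =
      g.hom (tmul R n x : BalancedTensor R N X)) : f = g := by
  ext z
  exact DFunLike.congr_fun (hom_ext (X := N) (Y := X) (f := f.hom.toAddMonoidHom)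
    (g := g.hom.toAddMonoidHom) h) z

instance : (functor S R N).Additive where
  map_add {X Y f g} := by
    ext z
    exact DFunLike.congr_fun (hom_ext (f := map (LinearMap.id : N →ₗ[Rᵐᵒᵖ] N) (f + g).hom)
      (g := map LinearMap.id f.hom + map LinearMap.id g.hom)
      fun x y => by rw [AddMonoidHom.add_apply]; exact tmul_add R x (f.hom y) (g.hom y)) z

/-- A right projective bimodule defines an exact functor: a dual basis of `N` exhibits `N ⊗ X` as a
natural retract of a power of `X`. -/
theorem functor_map_exact [Module.Finite Rᵐᵒᵖ N] [Module.Projective Rᵐᵒᵖ N]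
    (C : ShortComplex (ModuleCat.{u} R)) (hC : C.Exact) : (C.map (functor S R N)).Exact := by
  -- The dual basis consists of the elements `f (Pi.single j 1)` and the coordinates `g · j`.
  obtain ⟨m, f, g, -, -, hfg⟩ := Module.Finite.exists_comp_eq_id_of_projective Rᵐᵒᵖ N
  let ι (X : ModuleCat.{u} R) : BalancedTensor R N X →+ Fin m → X :=
    lift (AddMonoidHom.mk' (fun n => AddMonoidHom.mk' (fun x j => (g n j).unop • x)
        fun x y => funext fun j => smul_add _ x y)
        fun n n' => AddMonoidHom.ext fun x => funext fun j => by simp [add_smul])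
      fun n r x => funext fun j => by simp [mul_smul]
  let π (X : ModuleCat.{u} R) : (Fin m → X) →+ BalancedTensor R N X :=
    AddMonoidHom.mk' (fun y => ∑ j, tmul R (f (Pi.single j 1)) (y j))
      fun y y' => by simp [tmul_add, Finset.sum_add_distrib]
  have hπι (X : ModuleCat.{u} R) (z) : π X (ι X z) = z := by
    refine DFunLike.congr_fun (hom_ext (f := (π X).comp (ι X)) (g := AddMonoidHom.id _)
      fun n x => ?_) z
    change ∑ j, tmul R (f (Pi.single j 1)) ((g n j).unop • x) = tmul R n x
    simp_rw [← tmul_balanced, op_unop, ← sum_tmul, ← map_smul, ← map_sum]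
    congr 1
    conv_rhs => rw [← LinearMap.id_apply (R := Rᵐᵒᵖ) n, ← hfg, LinearMap.comp_apply]
    congr 1
    ext j
    simp [Finset.sum_apply, Pi.single_apply]
  have hι {X Y : ModuleCat.{u} R} (h : X ⟶ Y) (z : BalancedTensor R N X) (j : Fin m) :
      ι Y (map LinearMap.id h.hom z) j = h.hom (ι X z j) := by
    refine DFunLike.congr_fun (hom_ext
      (f := ((Pi.evalAddMonoidHom _ j).comp (ι Y)).comp (map LinearMap.id h.hom))
      (g := h.hom.toAddMonoidHom.comp ((Pi.evalAddMonoidHom _ j).comp (ι X))) fun n x => ?_) z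
    exact (map_smul h.hom (g n j).unop x).symm
  rw [ShortComplex.moduleCat_exact_iff] at hC ⊢
  intro (w : BalancedTensor R N C.X₂) hw
  have hw' : map LinearMap.id C.g.hom w = 0 := hw
  -- The coordinates of a cycle `w` are cycles; preimages of them assemble to a preimage of `w`.
  choose y hy using fun j => hC (ι _ w j) (by
    change C.g.hom _ = 0
    rw [← hι, hw', map_zero]; rfl)
  refine ⟨π _ y, ?_⟩
  change map LinearMap.id C.f.hom (∑ j, tmul R (f (Pi.single j 1)) (y j)) = w
  rw [map_sum]
  conv_rhs => rw [← hπι _ w]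
  exact Finset.sum_congr rfl fun j _ => congrArg (tmul R _) (hy j)

/-- A left projective bimodule defines a functor that preserves projectives: as `X` is a summand of
the free module on `X`, the module `N ⊗ X` is a summand of a direct sum of copies of `N`. -/
theorem projective_of_left [Module.Projective S N] (X : Type u) [AddCommGroup X] [Module R X]
    [Module.Projective R X] : Module.Projective S (BalancedTensor R N X) := by
  obtain ⟨s, hs⟩ := Module.projective_def'.1 ‹Module.Projective R X›
  let i : BalancedTensor R N X →ₗ[S] (X →₀ N) :=
    { lift (AddMonoidHom.mk' (fun n => AddMonoidHom.mk'
          (fun x => (s x).mapRange (fun a => op a • n) (by simp)) fun x y => by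
            ext; simp [add_smul])
          fun n n' => by ext; simp)
        fun n r x => by ext; simp [mul_smul] with
      map_smul' := fun t z => by
        induction z using induction_on with
        | zero => simp
        | tmul n x =>
          ext j
          exact (smul_comm t (op (s x j)) n).symm
        | add z z' h h' => simp_all }
  let p : (X →₀ N) →ₗ[S] BalancedTensor R N X := Finsupp.lsum ℕ fun x => tmulRight S x
  have : Module.Projective S (X →₀ N) := by
    classical
    exact .of_equiv (finsuppLequivDFinsupp S).symm
  refine Module.Projective.of_split i p (LinearMap.ext fun z => ?_)
  refine DFunLike.congr_fun (hom_ext (f := (p ∘ₗ i).toAddMonoidHom) (g := AddMonoidHom.id _)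
    fun n x => ?_) z
  change p ((s x).mapRange (fun a => op a • n) (by simp)) = tmul R n x
  rw [Finsupp.lsum_apply, Finsupp.sum_mapRange_index (by simp)]
  conv_rhs => rw [← LinearMap.id_apply (R := R) x, ← hs, LinearMap.comp_apply,
    Finsupp.linearCombination_apply, Finsupp.sum, tmul_sum]
  exact Finset.sum_congr rfl fun j _ => tmul_balanced R n _ j

end Functor

section Assoc

variable {S R R' M N : Type u} [Ring S] [Ring R] [Ring R'] [AddCommGroup M] [Module S M]
  [Module Rᵐᵒᵖ M] [SMulCommClass S Rᵐᵒᵖ M] [AddCommGroup N] [Module R N] [Module R'ᵐᵒᵖ N]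
  [SMulCommClass R R'ᵐᵒᵖ N]

variable (S R R' M N) in
/-- Associativity of the tensor product. -/
def assoc (X : Type u) [AddCommGroup X] [Module R' X] :
    BalancedTensor R' (BalancedTensor R M N) X ≃ₗ[S]
      BalancedTensor R M (BalancedTensor R' N X) where
  toFun := lift (AddMonoidHom.flip (AddMonoidHom.mk'
      (fun x => map LinearMap.id (tmulRight R x))
      fun x y => hom_ext fun m n => by
        rw [AddMonoidHom.add_apply, map_add (tmulRight R), map_tmul, LinearMap.add_apply]
        exact tmul_add R m (tmul R' n x) (tmul R' n y)))
    fun z r x => by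
      induction z using induction_on with
      | zero => simp
      | tmul m n => exact congrArg (tmul R m) (tmul_balanced R' n r x)
      | add z z' h h' => simp_all
  invFun := lift (AddMonoidHom.mk'
      (fun m => map (tmulLeft R' m) LinearMap.id)
      fun m m' => hom_ext fun n x => by
        rw [AddMonoidHom.add_apply, map_add (tmulLeft R'), map_tmul, LinearMap.add_apply]
        exact add_tmul R' (tmul R m n) (tmul R m' n) x)
    fun m r z => by
      induction z using induction_on with
      | zero => simp
      | tmul n x => exact congrArg (fun t => tmul R' t x) (tmul_balanced R m r n)
      | add z z' h h' => simp_all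
  map_add' := map_add _
  map_smul' s z := by
    induction z using induction_on with
    | zero => simp
    | tmul z x =>
      induction z using induction_on with
      | zero => simp [zero_tmul]
      | tmul m n => rfl
      | add z z' h h' => simp_all [add_tmul]
    | add z z' h h' => simp_all
  left_inv z := by
    induction z using induction_on with
    | zero => simp
    | tmul z x =>
      induction z using induction_on with
      | zero => simp [zero_tmul]
      | tmul m n => rfl
      | add z z' h h' => simp_all [add_tmul]
    | add z z' h h' => simp_all
  right_inv z := by
    induction z using induction_on with
    | zero => simp
    | tmul m z =>
      induction z using induction_on with
      | zero => simp [tmul_zero]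
      | tmul m n => rfl
      | add z z' h h' => simp_all [tmul_add]
    | add z z' h h' => simp_all

variable (S R R' M N) in
/-- Tensoring with `N` and then with `M` amounts to tensoring with `M ⊗ N`. -/
def functorComp : functor R R' N ⋙ functor S R M ≅ functor S R' (BalancedTensor R M N) :=
  NatIso.ofComponents (fun X => (assoc S R R' M N X).symm.toModuleIso) fun {X Y} f => by
    have key (φ : BalancedTensor R' N X →ₗ[R] BalancedTensor R' N Y)
        (hφ : ∀ n x, φ (tmul R' n x) = tmul R' n (f.hom x))
        (z : BalancedTensor R M (BalancedTensor R' N X)) :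
        (assoc S R R' M N Y).symm (map LinearMap.id φ z) =
          map LinearMap.id f.hom ((assoc S R R' M N X).symm z) := by
      induction z using induction_on with
      | zero => simp
      | tmul m z =>
        induction z using induction_on with
        | zero => simp [tmul_zero]
        | tmul n x => rw [map_tmul, hφ]; rfl
        | add z z' h h' => simp_all [tmul_add]
      | add z z' h h' => simp_all
    ext z
    exact key ((functor R R' N).map f).hom (fun _ _ => rfl) z

end Assoc
end BalancedTensor

/-! ### Bimodules that are the regular bimodule plus a projective bimodule -/

namespace BalancedTensor

/-- Tensoring a projective `A`-`B`-bimodule with any left `B`-module gives a projective `A`-module,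
because `(A ⊗[k] Bᵐᵒᵖ) ⊗_B X` is the free `A`-module `A ⊗[k] X`. -/
theorem projective_of_bimodule {k : Type w} {A B P X : Type u} [Field k] [Ring A] [Algebra k A]
    [Ring B] [Algebra k B] [AddCommGroup P] [Module k P] [Module A P] [Module Bᵐᵒᵖ P]
    [IsScalarTower k A P] [IsScalarTower k Bᵐᵒᵖ P] [SMulCommClass A Bᵐᵒᵖ P] [AddCommGroup X]
    [Module B X]
    (hP : letI : Module (A ⊗[k] Bᵐᵒᵖ) P := TensorProduct.Algebra.module
      Module.Projective (A ⊗[k] Bᵐᵒᵖ) P) :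
    Module.Projective A (BalancedTensor B P X) := by
  let _ : Module (A ⊗[k] Bᵐᵒᵖ) P := TensorProduct.Algebra.module
  let _ : Module k X := Module.compHom X (algebraMap k B)
  have : IsScalarTower k B X := .of_algebraMap_smul fun _ _ => rfl
  obtain ⟨s, hs⟩ := Module.projective_def'.1 hP
  let act (x : X) : Bᵐᵒᵖ →ₗ[k] X :=
    { toFun := fun b => b.unop • x
      map_add' := fun b b' => add_smul _ _ x
      map_smul' := fun c b => smul_assoc c b.unop x }
  -- The map `ψ x` sends `a ⊗ op b` to `a ⊗ (b • x)`.
  let ψ (x : X) : A ⊗[k] Bᵐᵒᵖ →ₗ[A] A ⊗[k] X :=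
    TensorProduct.AlgebraTensorModule.lTensor A A (act x)
  have act_add (x y : X) : act (x + y) = act x + act y :=
    LinearMap.ext fun b => smul_add b.unop x y
  have ψ_add (x y : X) : ψ (x + y) = ψ x + ψ y := by
    simp only [ψ, act_add, map_add]
  have ψ_op (r : B) (x : X) (t : A ⊗[k] Bᵐᵒᵖ) : ψ x ((1 ⊗ₜ op r) * t) = ψ (r • x) t := by
    induction t with
    | zero => simp
    | add t t' h h' => rw [mul_add, map_add, map_add, h, h']
    | tmul a b =>
      rw [Algebra.TensorProduct.tmul_mul_tmul, one_mul]
      exact congrArg (a ⊗ₜ[k] ·) (mul_smul b.unop r x)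
  have ψ_left (a : A) (x : X) (t : A ⊗[k] Bᵐᵒᵖ) : ψ x ((a ⊗ₜ 1) * t) = a • ψ x t := by
    have h : (a ⊗ₜ 1) * t = a • t := by
      induction t with
      | zero => simp
      | add t t' h h' => rw [mul_add, smul_add, h, h']
      | tmul a' b => rw [Algebra.TensorProduct.tmul_mul_tmul, one_mul]; rfl
    rw [h, map_smul]
  have smul_op (r : B) (p : P) : op r • p = ((1 : A) ⊗ₜ[k] op r) • p := by
    rw [TensorProduct.Algebra.smul_def, one_smul]
  have smul_left (a : A) (p : P) : a • p = (a ⊗ₜ[k] (1 : Bᵐᵒᵖ)) • p := by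
    rw [TensorProduct.Algebra.smul_def, one_smul]
  -- A section `s` of the free cover of `P` induces the section `p ⊗ x ↦ ψ x ∘ s p`.
  let i : BalancedTensor B P X →ₗ[A] (P →₀ A ⊗[k] X) :=
    { lift (AddMonoidHom.mk' (fun p => AddMonoidHom.mk'
          (fun x => (s p).mapRange (ψ x) (map_zero _)) fun x y => by
            ext j
            simp only [ψ_add, Finsupp.mapRange_apply, LinearMap.add_apply, Finsupp.add_apply])
          fun p q => by
            ext x j; simp only [map_add, Finsupp.mapRange_apply, AddMonoidHom.mk'_apply,
              AddMonoidHom.add_apply, Finsupp.add_apply])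
        fun p r x => by
          ext j
          simp only [smul_op, map_smul, AddMonoidHom.mk'_apply, Finsupp.mapRange_apply,
            Finsupp.smul_apply, smul_eq_mul, ψ_op] with
      map_smul' := fun a z => by
        induction z using induction_on with
        | zero => simp
        | tmul p x =>
          ext j
          change ψ x (s (a • p) j) = a • ψ x (s p j)
          rw [smul_left, map_smul, Finsupp.smul_apply, smul_eq_mul, ψ_left]
        | add z z' h h' => simp_all }
  -- On the summand indexed by `q`, the retraction sends `a ⊗ x` to `(a • q) ⊗ x`.
  let ρ (q : P) : A ⊗[k] X →ₗ[A] BalancedTensor B P X :=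
    { TensorProduct.liftAddHom (AddMonoidHom.mk' (fun a => AddMonoidHom.mk'
        (fun x => tmul B (a • q) x) fun x y => tmul_add B _ _ _)
        fun a a' => AddMonoidHom.ext fun x => by
          simp only [AddMonoidHom.mk'_apply, AddMonoidHom.add_apply, add_smul, add_tmul])
        fun c a x => by
          change tmul B ((c • a) • q) x = tmul B (a • q) (algebraMap k B c • x)
          rw [← tmul_balanced, smul_assoc, ← smul_comm a, ← algebraMap_smul Bᵐᵒᵖ c q, smul_comm a]
          rfl with
      map_smul' := fun a t => by
        induction t with
        | zero => simp
        | add t t' h h' => simp_all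
        | tmul a' x => exact congrArg (tmul B · x) (mul_smul a a' q) }
  have hρ (q : P) (x : X) (t : A ⊗[k] Bᵐᵒᵖ) : ρ q (ψ x t) = tmul B (t • q) x := by
    induction t with
    | zero =>
      rw [map_zero, map_zero]
      exact ((congrArg (tmul B · x) (zero_smul (A ⊗[k] Bᵐᵒᵖ) q)).trans (zero_tmul B x)).symm
    | add t t' h h' => rw [map_add, map_add, h, h', add_smul, add_tmul]
    | tmul a b =>
      rw [TensorProduct.Algebra.smul_def, smul_comm, ← op_unop b, tmul_balanced]
      rfl
  let π : (P →₀ A ⊗[k] X) →ₗ[A] BalancedTensor B P X := Finsupp.lsum ℕ ρ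
  have : Module.Projective A (P →₀ A ⊗[k] X) := by
    classical
    exact .of_equiv (finsuppLequivDFinsupp A).symm
  refine Module.Projective.of_split i π (LinearMap.ext fun z => ?_)
  refine DFunLike.congr_fun (hom_ext (f := (π ∘ₗ i).toAddMonoidHom) (g := AddMonoidHom.id _)
    fun p x => ?_) z
  change π ((s p).mapRange (ψ x) (map_zero _)) = tmul B p x
  rw [Finsupp.lsum_apply, Finsupp.sum_mapRange_index (by simp)]
  conv_rhs => rw [← LinearMap.id_apply (R := A ⊗[k] Bᵐᵒᵖ) p, ← hs, LinearMap.comp_apply,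
    Finsupp.linearCombination_apply, Finsupp.sum, sum_tmul]
  exact Finset.sum_congr rfl fun q _ => hρ q x _

section Regular

variable {A Z : Type u} [Ring A] [AddCommGroup Z] [Module A Z] [Module Aᵐᵒᵖ Z]
  [SMulCommClass A Aᵐᵒᵖ Z]

/-- A bimodule map `p : Z → A` induces the natural map `Z ⊗ X → X`, `z ⊗ x ↦ p z • x`. -/
def functorToId (p : Z →+ A) (hl : ∀ a z, p (a • z) = a * p z)
    (hr : ∀ a z, p (op a • z) = p z * a) : functor A A Z ⟶ 𝟭 _ where
  app X := ModuleCat.ofHom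
    { lift (AddMonoidHom.mk' (fun z => AddMonoidHom.mk' (fun x : X => p z • x) (smul_add _))
        fun z z' => AddMonoidHom.ext fun x => by simp [add_smul])
        fun z a x => by simp [hr, mul_smul] with
      map_smul' := fun a z => by
        induction z using induction_on with
        | zero => simp
        | tmul z x => simp [smul_tmul, hl, mul_smul]
        | add z z' h h' => simp_all }
  naturality X Y f := by
    exact functor_obj_hom_ext fun z x => (map_smul f.hom (p z) x).symm

/-- A central element `u` of a bimodule `Z` induces the natural map `X → Z ⊗ X`, `x ↦ u ⊗ x`. -/
def idToFunctor (u : Z) (hu : ∀ a : A, a • u = op a • u) : 𝟭 _ ⟶ functor A A Z where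
  app X := ModuleCat.ofHom
    { toFun := fun x => tmul A u x
      map_add' := tmul_add A u
      map_smul' := fun a x => by
        rw [← tmul_balanced, ← hu]; rfl }

/-- If the bimodule `Z` is the direct sum of the regular bimodule and `P`, then `Z ⊗ X` is naturally
the direct sum of `X` and `P ⊗ X`. -/
theorem exists_decomposition {P : Type u} [AddCommGroup P] [Module A P] [Module Aᵐᵒᵖ P]
    [SMulCommClass A Aᵐᵒᵖ P] (e : Z ≃+ A × P) (hl : ∀ (a : A) z, e (a • z) = a • e z)
    (hr : ∀ (a : A) z, e (op a • z) = op a • e z) :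
    ∃ r : Retract (𝟭 _) (functor A A Z), ∀ X : ModuleCat.{u} A,
      ∃ (c : (functor A A Z).obj X ⟶ ModuleCat.of A (BalancedTensor A P X))
        (d : ModuleCat.of A (BalancedTensor A P X) ⟶ (functor A A Z).obj X),
        r.r.app X ≫ r.i.app X + c ≫ d = 𝟙 _ := by
  have hl' (a : A) (t : A × P) : e.symm (a • t) = a • e.symm t := by
    rw [e.symm_apply_eq, hl, e.apply_symm_apply]
  have hr' (a : A) (t : A × P) : e.symm (op a • t) = op a • e.symm t := by
    rw [e.symm_apply_eq, hr, e.apply_symm_apply]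
  let p : Z →+ A := (AddMonoidHom.fst A P).comp e.toAddMonoidHom
  let ε : functor A A Z ⟶ 𝟭 _ := functorToId p
    (fun a z => congrArg Prod.fst (hl a z)) (fun a z => congrArg Prod.fst (hr a z))
  let η : 𝟭 _ ⟶ functor A A Z := idToFunctor (e.symm (1, 0)) fun a => by
    rw [← hl', ← hr']; simp
  refine ⟨⟨η, ε, ?_⟩, fun X => ?_⟩
  · ext X x
    change p (e.symm (1, 0)) • x = x
    simp [p]
  · let σ : Z →ₗ[Aᵐᵒᵖ] P :=
      { (AddMonoidHom.snd A P).comp e.toAddMonoidHom with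
        map_smul' := fun a z => congrArg Prod.snd (hr a.unop z) }
    let χ : P →ₗ[Aᵐᵒᵖ] Z :=
      { e.symm.toAddMonoidHom.comp (AddMonoidHom.inr A P) with
        map_smul' := fun a q => by
          change e.symm (0, a • q) = a • e.symm (0, q)
          rw [← op_unop a, ← hr']; simp }
    refine ⟨ModuleCat.ofHom { map σ LinearMap.id with map_smul' := fun a z => ?_ },
      ModuleCat.ofHom { map χ LinearMap.id with map_smul' := fun a z => ?_ }, ?_⟩
    · induction z using induction_on with
      | zero => simp
      | tmul z x => exact congrArg (tmul A · x) (congrArg Prod.snd (hl a z))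
      | add z z' h h' => simp_all
    · induction z using induction_on with
      | zero => simp
      | tmul q x =>
        refine congrArg (tmul A · x) (?_ : e.symm (0, a • q) = a • e.symm (0, q))
        rw [← hl']; simp
      | add z z' h h' => simp_all
    · refine functor_obj_hom_ext fun z x => ?_
      change tmul A (e.symm (1, 0)) ((e z).1 • x) + tmul A (e.symm (0, (e z).2)) x = tmul A z x
      rw [← tmul_balanced, ← hr', ← add_tmul, ← map_add]
      congr 1
      rw [e.symm_apply_eq]
      ext <;> simp

end Regular

end BalancedTensor

/-! ### Stable equivalences of Morita type -/

namespace FDBimodule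

variable {k : Type w} {A B : Type u} [Field k] [Ring A] [Algebra k A] [Ring B] [Algebra k B]

theorem DefineStableEquivalence.symm {M : FDBimodule k A B} {N : FDBimodule k B A}
    (h : M.DefineStableEquivalence N) : N.DefineStableEquivalence M :=
  ⟨h.projective_left_N, h.projective_right_N, h.projective_left_M, h.projective_right_M,
    h.tensor_N_M, h.tensor_M_N⟩

open Limits BalancedTensor in
/-- The functor `N ⊗_A -` has `M ⊗_B -` as a left inverse up to projective summands: the composite
is `(M ⊗_B N) ⊗_A -`, and `M ⊗_B N` is the regular bimodule plus a projective one. -/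
theorem DefineStableEquivalence.hasLeftInverseUpToProjectives {M : FDBimodule k A B}
    {N : FDBimodule k B A} (h : M.DefineStableEquivalence N) :
    HasLeftInverseUpToProjectives (functor B A N) (functor A B M) := by
  have := h.projective_right_N
  have := h.projective_left_N
  have : Module.Finite Aᵐᵒᵖ N := .of_restrictScalars_finite k _ _
  have : Module.Finite B N := .of_restrictScalars_finite k _ _
  have hexact := ((functor B A N).exact_tfae.out 1 3).1 functor_map_exact
  obtain ⟨P, hP, e, hl, hr⟩ := h.tensor_M_N
  have : Module.Finite A P := .of_restrictScalars_finite k _ _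
  obtain ⟨r, hdec⟩ := exists_decomposition e hl hr
  let φ := functorComp A B A M N
  refine ⟨inferInstance, hexact.1, hexact.2, ⟨fun {X} _ => ?_⟩,
    fun X _ => BalancedTensor.finite (R := A) (X := N) (Y := X) B, ⟨r.trans (.ofIso φ.symm)⟩,
    fun X => ?_⟩
  · have : Module.Projective A X := (IsProjective.iff_projective _).2 inferInstance
    exact (IsProjective.iff_projective _).1 (projective_of_left (S := B) (R := A) (N := N) X)
  · obtain ⟨c, d, hcd⟩ := hdec X
    refine ⟨_, φ.hom.app X ≫ r.r.app X, r.i.app X ≫ φ.inv.app X, φ.hom.app X ≫ c,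
      d ≫ φ.inv.app X, ?_, (IsProjective.iff_projective _).1 (projective_of_bimodule hP),
      fun _ => BalancedTensor.finite (R := A) (X := P) (Y := X) A⟩
    calc _ = φ.hom.app X ≫ (r.r.app X ≫ r.i.app X + c ≫ d) ≫ φ.inv.app X := by
          simp
      _ = 𝟙 _ := by rw [hcd]; simp

end FDBimodule

theorem mainTheorem6 {k : Type w} [Field k] {A B : Type u}
    [Ring A] [Algebra k A] [FiniteDimensional k A]
    [Ring B] [Algebra k B] [FiniteDimensional k B]
    (n : ℕ) (hn : 1 ≤ n)
    (hA : HasNoSeparableSummand k A) (hA' : IsSeparableAlgebra k (A ⧸ Ring.jacobson A))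
    (hB : HasNoSeparableSummand k B) (hB' : IsSeparableAlgebra k (B ⧸ Ring.jacobson B))
    (hAn : IsRepresentationFinite n A) :
    (StablyEquivalentOfMoritaType k A B → IsRepresentationFinite n B) ∧
    (∀ (M : FDBimodule k A B) (N : FDBimodule k B A), M.DefineStableEquivalence N →
      ∀ (T : Type u) [AddCommGroup T] [Module A T],
        IsClusterTilting n A T → IsClusterTilting n B (BalancedTensor A N T)) := by
  have key (M : FDBimodule k A B) (N : FDBimodule k B A) (h : M.DefineStableEquivalence N)
      (T : Type u) [AddCommGroup T] [Module A T] (hT : IsClusterTilting n A T) :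
      IsClusterTilting n B (BalancedTensor A N T) :=
    h.hasLeftInverseUpToProjectives.isClusterTilting_obj h.symm.hasLeftInverseUpToProjectives
      (T := ModuleCat.of A T) hT
  refine ⟨fun ⟨M, N, h⟩ => ⟨fun hn2 => ?_, ?_⟩, key⟩
  · exact h.symm.hasLeftInverseUpToProjectives.globalDimensionLE (hAn.globalDimension hn2)
  · obtain ⟨T, _, _, hT⟩ := hAn.exists_clusterTilting
    exact ⟨BalancedTensor A N T, inferInstance, inferInstance, key M N h T hT⟩
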